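/- **Theorem A (Tits' Alternative).** Let $\mathbb{X}=\prod_{i=1}^{D}X_i$ be a finite product of complete separable geodesic metric spaces, each $\delta$-hyperbolic for some common $\delta$ (for every geodesic triangle, the fibres of the map to its comparison tripod have diameter at most $\delta$), equipped with the $\ell^p$-product metric $d$ for some $p\in[1,\infty]$. Let $\mathrm{Aut}\,\mathbb{X}$ be the group of those isometries of $\mathbb{X}$ which permute the factors and act through isometries between the factors, i.e. the maps $f$ for which there are a permutation $\sigma$ of $\{1,\dots,D\}$ and surjective isometries $e_i:X_i\to X_{\sigma(i)}$ with $f(x)_{\sigma(i)}=e_i(x_i)$ for all $x$ and $i$. Let $\Gamma$ be a countable discrete group and $\Gamma\to\mathrm{Aut}\,\mathbb{X}$ a homomorphism such that the resulting action on $\mathbb{X}$ is - acylindrical: for every $\epsilon>0$ there are $R\ge 0$ and $N\in\mathbb{N}$ such that for all $x,y\in\mathbb{X}$ with $d(x,y)\ge R$ at most $N$ elements $g\in\Gamma$ satisfy both $d(gx,x)\le\epsilon$ and $d(gy,y)\le\epsilon$; and - not elliptic: not all orbits of $\Gamma$ in $\mathbb{X}$ are bounded. Then either $\Gamma$ contains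 a free group of rank $2$, or $\Gamma$ is virtually isomorphic to $\mathbb{Z}^k$ for some $k$ with $1\le k\le D$. Here two groups $\Gamma,\Lambda$ are virtually isomorphic if there are finite index subgroups $\Gamma'\le\Gamma$, $\Lambda'\le\Lambda$ and finite normal subgroups $K\trianglelefteq\Gamma'$, $L\trianglelefteq\Lambda'$ with $\Gamma'/K\cong\Lambda'/L$. -/

import Mathlib

open scoped ENNReal

/-! ### Geodesic and hyperbolic metric spaces -/

/-- `γ` restricted to `[0, d(a,b)]` is a geodesic from `a` to `b`, parametrised by arc length. -/
def IsGeodesicFromTo {X : Type*} [MetricSpace X] (γ : ℝ → X) (a b : X) : Prop :=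
  γ 0 = a ∧ γ (dist a b) = b ∧
    ∀ s ∈ Set.Icc (0 : ℝ) (dist a b), ∀ t ∈ Set.Icc (0 : ℝ) (dist a b),
      dist (γ s) (γ t) = |s - t|

/-- Any two points are joined by a geodesic. -/
def IsGeodesicSpace (X : Type*) [MetricSpace X] : Prop :=
  ∀ a b : X, ∃ γ : ℝ → X, IsGeodesicFromTo γ a b

/-- The Gromov product `⟨x, y⟩_o`. -/
noncomputable def gromovProduct {X : Type*} [MetricSpace X] (o x y : X) : ℝ :=
  (dist x o + dist o y - dist x y) / 2

/-- A geodesic space is `δ`-hyperbolic if, for every geodesic triangle, the fibres of the map to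
its comparison tripod have diameter at most `δ`.  The leg of the tripod at the vertex coming from
`a` has length `⟨b, c⟩_a`, and two points on different sides lie in the same fibre exactly when
they lie on the two sides issuing from a common vertex `a`, at the same distance
`t ≤ ⟨b, c⟩_a` from it (`t = ⟨b, c⟩_a` for the fibre over the centre). -/
def IsHyperbolicSpace (δ : ℝ) (X : Type*) [MetricSpace X] : Prop :=
  IsGeodesicSpace X ∧
    ∀ (a b c : X) (γ η : ℝ → X), IsGeodesicFromTo γ a b → IsGeodesicFromTo η a c →
      ∀ t ∈ Set.Icc (0 : ℝ) (gromovProduct a b c), dist (γ t) (η t) ≤ δ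

/-! ### Isometric actions -/

section Actions

variable {Γ Y : Type*} [Group Γ] [MetricSpace Y]

/-- The `ε`-coarse stabilizer of a set `S` of points. -/
def coarseStabilizer (ρ : Γ →* (Y ≃ᵢ Y)) (ε : ℝ) (S : Set Y) : Set Γ :=
  {g | ∀ x ∈ S, dist (ρ g x) x ≤ ε}

/-- Acylindrical actions by isometries. -/
def IsAcylindrical (ρ : Γ →* (Y ≃ᵢ Y)) : Prop :=
  ∀ ε : ℝ, 0 < ε → ∃ (R : ℝ) (N : ℕ), 0 ≤ R ∧
    ∀ x y : Y, R ≤ dist x y → (coarseStabilizer ρ ε {x, y}).encard ≤ N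

/-- Elliptic actions by isometries: all orbits are bounded. -/
def IsElliptic (ρ : Γ →* (Y ≃ᵢ Y)) : Prop :=
  ∀ x : Y, Bornology.IsBounded (Set.range fun g : Γ => ρ g x)

end Actions

/-! ### Automorphisms of a finite product -/

/-- The automorphism group of the product of `X 0, …, X (D - 1)` with its `ℓ^p` metric: the
isometries that permute (isometric) factors through isometries between the factors. -/
def autProd {D : ℕ} (p : ℝ≥0∞) [Fact (1 ≤ p)] (X : Fin D → Type*) [∀ i, MetricSpace (X i)] :
    Subgroup (PiLp p X ≃ᵢ PiLp p X) where
  carrier := {f | ∃ σ : Equiv.Perm (Fin D), ∀ i, ∃ e : X i ≃ᵢ X (σ i),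
    ∀ x : PiLp p X, f x (σ i) = e (x i)}
  one_mem' := ⟨1, fun i => ⟨IsometryEquiv.refl (X i), fun _ => rfl⟩⟩
  mul_mem' := by
    rintro f g ⟨σ, hf⟩ ⟨τ, hg⟩
    refine ⟨σ * τ, fun i => ?_⟩
    obtain ⟨e, he⟩ := hg i
    obtain ⟨e', he'⟩ := hf (τ i)
    refine ⟨e.trans e', fun x => ?_⟩
    change f (g x) (σ (τ i)) = e' (e (x i))
    rw [he', he]
  inv_mem' := by
    rintro f ⟨σ, hf⟩
    refine ⟨σ⁻¹, fun j => ?_⟩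
    have key : ∀ k, σ k = j → ∃ e : X j ≃ᵢ X k, ∀ x : PiLp p X, f⁻¹ x k = e (x j) := by
      rintro k rfl
      obtain ⟨e, he⟩ := hf k
      refine ⟨e.symm, fun x => ?_⟩
      have h := he (f⁻¹ x)
      rw [IsometryEquiv.apply_inv_self] at h
      rw [h, IsometryEquiv.symm_apply_apply]
    exact key (σ⁻¹ j) (σ.apply_symm_apply j)

/-! ### Virtual isomorphism -/

/-- `G` and `H` have finite index subgroups with isomorphic quotients by finite normal
subgroups. -/
def VirtuallyIsomorphic (G H : Type*) [Group G] [Group H] : Prop :=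
  ∃ (G' : Subgroup G) (H' : Subgroup H) (K : Subgroup G') (L : Subgroup H')
    (_ : K.Normal) (_ : L.Normal),
    G'.FiniteIndex ∧ H'.FiniteIndex ∧ Finite K ∧ Finite L ∧ Nonempty (G' ⧸ K ≃* H' ⧸ L)

/-!
A group acting on a hyperbolic space has a bounded orbit, contains a free group of rank two, or
virtually fixes a boundary point. Indeed, let `g` be a loxodromic element. If some `h` maps the two
endpoints of `g` to points different from both, then powers of `g` and of `h * g * h⁻¹` play
ping-pong; otherwise finitely many cosets of the stabilizers of the endpoints cover the group, and
one of these stabilizers has finite index. If there is no loxodromic element, then an unbounded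
orbit converges to a fixed boundary point. Hence, if `Γ` has no free subgroup, some finite index
subgroup `Γ₀` has a bounded orbit or a fixed boundary point in every factor.

The horofunction at a fixed boundary point restricts to a quasimorphism on an orbit, and bounds the
displacement of every `g` along a sequence of points going to infinity. On factors with a bounded
orbit the zero function does the same along a constant sequence. By acylindricity only finitely many
elements of `Γ₀` have small values under all these quasimorphisms. In particular there are finitely
many commutators, so the homogenizations are homomorphisms; together they map `Γ₀` to `ℝ ^ D` with
finite kernel and discrete image, that is, onto a copy of `ℤ ^ k`. Were `k = 0`, then `Γ₀` would be
finite and the action elliptic.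
-/

open Filter Topology

/-! ### Gromov products and hyperbolicity -/

section GromovProduct

variable {X : Type*} [MetricSpace X]

theorem gromovProduct_comm (o x y : X) : gromovProduct o x y = gromovProduct o y x := by
  unfold gromovProduct
  rw [dist_comm x y, dist_comm x o, dist_comm o y]
  ring

theorem gromovProduct_nonneg (o x y : X) : 0 ≤ gromovProduct o x y := by
  unfold gromovProduct
  linarith [dist_triangle x o y]

theorem gromovProduct_self (o x : X) : gromovProduct o x x = dist o x := by
  unfold gromovProduct
  rw [dist_self, dist_comm x o]
  ring

theorem gromovProduct_base_left (o x : X) : gromovProduct o o x = 0 := by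
  simp [gromovProduct]

theorem gromovProduct_base_right (o x : X) : gromovProduct o x o = 0 := by
  simp [gromovProduct]

theorem gromovProduct_le_dist_left (o x y : X) : gromovProduct o x y ≤ dist o x := by
  unfold gromovProduct
  linarith [dist_triangle o x y, dist_comm o x]

theorem gromovProduct_le_dist_right (o x y : X) : gromovProduct o x y ≤ dist o y :=
  gromovProduct_comm o x y ▸ gromovProduct_le_dist_left o y x

theorem gromovProduct_add_gromovProduct (o x y : X) :
    gromovProduct o x y + gromovProduct x o y = dist o x := by
  unfold gromovProduct
  linarith [dist_comm o x]

theorem gromovProduct_le_add_dist_base (o o' x y : X) :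
    gromovProduct o x y ≤ gromovProduct o' x y + dist o o' := by
  unfold gromovProduct
  linarith [dist_triangle x o' o, dist_triangle o o' y, dist_comm o o']

theorem gromovProduct_le_add_dist_right (o x y y' : X) :
    gromovProduct o x y ≤ gromovProduct o x y' + dist y y' := by
  unfold gromovProduct
  linarith [dist_triangle o y' y, dist_triangle x y y', dist_comm y y']

section Action

variable {G : Type*} [Group G] [MulAction G X] [IsIsometricSMul G X]

theorem gromovProduct_smul (g : G) (o x y : X) :
    gromovProduct (g • o) (g • x) (g • y) = gromovProduct o x y := by
  simp only [gromovProduct, dist_smul]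

theorem gromovProduct_base_smul (g : G) (o x y : X) :
    gromovProduct (g • o) x y = gromovProduct o (g⁻¹ • x) (g⁻¹ • y) := by
  rw [← gromovProduct_smul g o, smul_inv_smul, smul_inv_smul]

theorem dist_inv_smul_self (o : X) (g : G) : dist o (g⁻¹ • o) = dist o (g • o) := by
  rw [← dist_smul g, smul_inv_smul, dist_comm]

theorem gromovProduct_smul_mul_smul (o : X) (g h : G) :
    gromovProduct o (g • o) ((g * h) • o) =
      dist o (g • o) - gromovProduct o (g⁻¹ • o) (h • o) := by
  rw [← gromovProduct_add_gromovProduct o (g • o) ((g * h) • o), gromovProduct_base_smul, mul_smul,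
    inv_smul_smul, add_sub_cancel_right]

theorem dist_mul_smul (o : X) (g h : G) :
    dist o ((g * h) • o) =
      dist o (g • o) + dist o (h • o) - 2 * gromovProduct o (g⁻¹ • o) (h • o) := by
  have hdist : dist (g⁻¹ • o) (h • o) = dist o ((g * h) • o) := by
    rw [← dist_smul g, smul_inv_smul, mul_smul]
  rw [gromovProduct, hdist, dist_comm _ o, dist_inv_smul_self]
  ring

end Action

/-- Gromov's four point formulation of hyperbolicity, which needs no geodesics. -/
def IsGromovHyperbolic (δ : ℝ) (X : Type*) [MetricSpace X] : Prop :=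
  ∀ o x y z : X, min (gromovProduct o x y) (gromovProduct o y z) ≤ gromovProduct o x z + δ

namespace IsGromovHyperbolic

variable {δ : ℝ}

theorem nonneg (hX : IsGromovHyperbolic δ X) (o : X) : 0 ≤ δ := by
  simpa [gromovProduct_self] using hX o o o o

theorem dist_add_dist_le (hX : IsGromovHyperbolic δ X) (x y z w : X) :
    dist x y + dist z w ≤ max (dist x z + dist y w) (dist x w + dist y z) + 2 * δ := by
  have hmin := hX w x z y
  unfold gromovProduct at hmin
  rcases min_le_iff.1 hmin with h | h
  · linarith [le_max_left (dist x z + dist y w) (dist x w + dist y z), dist_comm w y,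
      dist_comm w z]
  · linarith [le_max_right (dist x z + dist y w) (dist x w + dist y z), dist_comm w y,
      dist_comm z y, dist_comm w z]

/-- Seen from `o` the points `x` and `y` are so close to each other that the pairing
`dist p q + dist x y` cannot realise the maximum in the four point inequality. -/
theorem abs_dist_sub_dist_sub_le (hX : IsGromovHyperbolic δ X) {o p q x y : X}
    (hxy : dist p q + dist o p + dist o q + 2 * δ < 2 * gromovProduct o x y) :
    |dist p x - dist q x - (dist p y - dist q y)| ≤ 2 * δ := by
  have key : ∀ u v, dist p q + dist o p + dist o q + 2 * δ < 2 * gromovProduct o u v →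
      dist p u - dist q u - (dist p v - dist q v) ≤ 2 * δ := by
    intro u v huv
    have hfour := hX.dist_add_dist_le p u q v
    unfold gromovProduct at huv
    rcases max_cases (dist p q + dist u v) (dist p v + dist u q) with ⟨h, -⟩ | ⟨h, -⟩
    · linarith [dist_triangle o p u, dist_triangle o q v, dist_comm u o]
    · linarith [dist_comm u q]
  exact abs_sub_le_iff.2 ⟨key x y hxy, key y x (gromovProduct_comm o x y ▸ hxy)⟩

end IsGromovHyperbolic

theorem IsGeodesicFromTo.dist_left {γ : ℝ → X} {a b : X} (h : IsGeodesicFromTo γ a b) {t : ℝ}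
    (ht : t ∈ Set.Icc 0 (dist a b)) : dist a (γ t) = t := by
  have hdist := h.2.2 0 ⟨le_rfl, dist_nonneg⟩ t ht
  rwa [h.1, zero_sub, abs_neg, abs_of_nonneg ht.1] at hdist

theorem IsGeodesicFromTo.dist_right {γ : ℝ → X} {a b : X} (h : IsGeodesicFromTo γ a b) {t : ℝ}
    (ht : t ∈ Set.Icc 0 (dist a b)) : dist (γ t) b = dist a b - t := by
  have hdist := h.2.2 t ht (dist a b) ⟨dist_nonneg, le_rfl⟩
  rwa [h.2.1, abs_sub_comm, abs_of_nonneg (sub_nonneg.2 ht.2)] at hdist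

theorem IsHyperbolicSpace.isGromovHyperbolic {δ : ℝ} (hX : IsHyperbolicSpace δ X) :
    IsGromovHyperbolic δ X := by
  intro o x y z
  obtain ⟨γx, hx⟩ := hX.1 o x
  obtain ⟨γy, hy⟩ := hX.1 o y
  obtain ⟨γz, hz⟩ := hX.1 o z
  set t := min (gromovProduct o x y) (gromovProduct o y z)
  have ht : 0 ≤ t := le_min (gromovProduct_nonneg _ _ _) (gromovProduct_nonneg _ _ _)
  have htxy : t ≤ gromovProduct o x y := min_le_left _ _
  have htyz : t ≤ gromovProduct o y z := min_le_right _ _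
  have hfellow_xy : dist (γx t) (γy t) ≤ δ := hX.2 o x y γx γy hx hy t ⟨ht, htxy⟩
  have hfellow_yz : dist (γy t) (γz t) ≤ δ := hX.2 o y z γy γz hy hz t ⟨ht, htyz⟩
  have hdx := hx.dist_right ⟨ht, htxy.trans (gromovProduct_le_dist_left _ _ _)⟩
  have hdz := hz.dist_right ⟨ht, htyz.trans (gromovProduct_le_dist_right _ _ _)⟩
  have hdxz := dist_triangle4 x (γx t) (γz t) z
  unfold gromovProduct
  linarith [dist_triangle (γx t) (γy t) (γz t), dist_comm x (γx t), dist_comm x o]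

end GromovProduct

/-! ### The boundary at infinity -/

section Boundary

variable {X : Type*} [MetricSpace X] {δ : ℝ} {x y z : ℕ → X}

/-- The two sequences converge to the same point at infinity. The relation is symmetric and, in a
hyperbolic space, transitive, but not reflexive: `Asymptotic x x` says that `x` is a Gromov
sequence, that is, converges at infinity. -/
def Asymptotic (x y : ℕ → X) : Prop :=
  ∀ o, Tendsto (fun n : ℕ × ℕ => gromovProduct o (x n.1) (y n.2)) atTop atTop

namespace Asymptotic

theorem of_tendsto {o : X}
    (h : Tendsto (fun n : ℕ × ℕ => gromovProduct o (x n.1) (y n.2)) atTop atTop) :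
    Asymptotic x y := fun o' =>
  tendsto_atTop_mono (fun _ => sub_le_iff_le_add.2 (gromovProduct_le_add_dist_base o o' _ _))
    (tendsto_atTop_add_const_right _ (-dist o o') h)

theorem exists_forall_ge (h : Asymptotic x y) (o : X) (B : ℝ) :
    ∃ N, ∀ m ≥ N, ∀ n ≥ N, B ≤ gromovProduct o (x m) (y n) :=
  eventually_atTop_prod_self'.1 (tendsto_atTop.1 (h o) B)

theorem tendsto_diagonal (h : Asymptotic x y) (o : X) :
    Tendsto (fun n => gromovProduct o (x n) (y n)) atTop atTop :=
  (h o).comp tendsto_atTop_diagonal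

theorem tendsto_dist (h : Asymptotic x x) (o : X) :
    Tendsto (fun n => dist o (x n)) atTop atTop := by
  simpa only [gromovProduct_self] using h.tendsto_diagonal o

theorem symm (h : Asymptotic x y) : Asymptotic y x := by
  refine fun o => tendsto_atTop.2 fun B => ?_
  obtain ⟨N, hN⟩ := h.exists_forall_ge o B
  exact eventually_atTop_prod_self'.2
    ⟨N, fun m hm n hn => gromovProduct_comm o _ _ ▸ hN n hn m hm⟩

theorem trans (hX : IsGromovHyperbolic δ X) (hxy : Asymptotic x y) (hyz : Asymptotic y z) :
    Asymptotic x z := by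
  refine fun o => tendsto_atTop.2 fun B => ?_
  obtain ⟨N, hN⟩ := hxy.exists_forall_ge o (B + δ)
  obtain ⟨N', hN'⟩ := hyz.exists_forall_ge o (B + δ)
  refine eventually_atTop_prod_self'.2 ⟨max N N', fun m hm n hn => ?_⟩
  have hxy' := hN m (le_of_max_le_left hm) (max N N') (le_max_left _ _)
  have hyz' := hN' (max N N') (le_max_right _ _) n (le_of_max_le_right hn)
  linarith [hX o (x m) (y (max N N')) (z n), le_min hxy' hyz']

theorem trans_dist_le {C : ℝ} (hxy : Asymptotic x y) (hyz : ∀ n, dist (y n) (z n) ≤ C) :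
    Asymptotic x z := fun o =>
  tendsto_atTop_mono
    (fun n => sub_le_iff_le_add.2 ((gromovProduct_le_add_dist_right o (x n.1) _ _).trans
      (by gcongr; exact hyz n.2)))
    (tendsto_atTop_add_const_right _ (-C) (hxy o))

theorem smul {G : Type*} [Group G] [MulAction G X] [IsIsometricSMul G X] (h : Asymptotic x y)
    (g : G) : Asymptotic (fun n => g • x n) fun n => g • y n := fun o => by
  simpa only [gromovProduct_base_smul, inv_inv] using h (g⁻¹ • o)

theorem eventually_gromovProduct_le (hX : IsGromovHyperbolic δ X) (hx : Asymptotic x x)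
    (hy : Asymptotic y y) (hxy : ¬ Asymptotic x y) (o : X) :
    ∃ K : ℝ, ∀ᶠ n in atTop, gromovProduct o (x n) (y n) ≤ K := by
  obtain ⟨B, hB⟩ : ∃ B : ℝ, ∀ N, ∃ m ≥ N, ∃ n ≥ N, gromovProduct o (x m) (y n) < B := by
    by_contra! hcon
    exact hxy (of_tendsto (tendsto_atTop.2 fun B => eventually_atTop_prod_self'.2 (hcon B)))
  obtain ⟨N, hN⟩ := hx.exists_forall_ge o (B + 2 * δ)
  obtain ⟨N', hN'⟩ := hy.exists_forall_ge o (B + 2 * δ)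
  refine ⟨B + 2 * δ, eventually_atTop.2 ⟨max N N', fun n hn => ?_⟩⟩
  obtain ⟨k, hk, l, hl, hkl⟩ := hB (max N N')
  have hxx := hN k (le_of_max_le_left hk) n (le_of_max_le_left hn)
  have hyy := hN' n (le_of_max_le_right hn) l (le_of_max_le_right hl)
  have hδ := hX.nonneg o
  rcases min_le_iff.1 (hX o (x k) (x n) (y l)) with h | h
  · linarith
  · rcases min_le_iff.1 (hX o (x n) (y n) (y l)) with h' | h' <;> linarith

end Asymptotic

/-- Gromov sequences up to the relation of converging to the same point at infinity. -/
def boundarySetoid (hX : IsGromovHyperbolic δ X) : Setoid {x : ℕ → X // Asymptotic x x} where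
  r x y := Asymptotic x.1 y.1
  iseqv := ⟨fun x => x.2, Asymptotic.symm, Asymptotic.trans hX⟩

/-- The Gromov boundary of a hyperbolic space. -/
def GromovBoundary (hX : IsGromovHyperbolic δ X) : Type _ :=
  Quotient (boundarySetoid hX)

variable {hX : IsGromovHyperbolic δ X} {ξ η : GromovBoundary hX}

/-- Convergence of a sequence of points of `X` to a point of the Gromov boundary. -/
def ConvergesTo (x : ℕ → X) (ξ : GromovBoundary hX) : Prop :=
  ∃ hx : Asymptotic x x, (Quotient.mk _ ⟨x, hx⟩ : GromovBoundary hX) = ξ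

theorem GromovBoundary.exists_convergesTo (ξ : GromovBoundary hX) : ∃ x, ConvergesTo x ξ := by
  obtain ⟨x, hx⟩ := Quotient.exists_rep ξ
  exact ⟨x.1, x.2, hx⟩

theorem Asymptotic.exists_convergesTo (hX : IsGromovHyperbolic δ X) (hx : Asymptotic x x) :
    ∃ ξ : GromovBoundary hX, ConvergesTo x ξ :=
  ⟨_, hx, rfl⟩

namespace ConvergesTo

theorem asymptotic_iff (hx : ConvergesTo x ξ) (hy : ConvergesTo y η) :
    Asymptotic x y ↔ ξ = η := by
  obtain ⟨_, rfl⟩ := hx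
  obtain ⟨_, rfl⟩ := hy
  exact ⟨fun h => Quotient.sound h, fun h => Quotient.exact h⟩

theorem asymptotic_self (hx : ConvergesTo x ξ) : Asymptotic x x :=
  hx.1

theorem of_asymptotic (hx : ConvergesTo x ξ) (hxy : Asymptotic x y) : ConvergesTo y ξ := by
  obtain ⟨_, rfl⟩ := hx
  exact ⟨hxy.symm.trans hX hxy, Quotient.sound hxy.symm⟩

theorem eventually_gromovProduct_le (hx : ConvergesTo x ξ) (hy : ConvergesTo y η) (hne : ξ ≠ η)
    (o : X) : ∃ K : ℝ, ∀ᶠ n in atTop, gromovProduct o (x n) (y n) ≤ K :=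
  hx.asymptotic_self.eventually_gromovProduct_le hX hy.asymptotic_self
    (mt (hx.asymptotic_iff hy).1 hne) o

end ConvergesTo

section Action

variable {G : Type*} [Group G] [MulAction G X] [IsIsometricSMul G X]

instance : MulAction G (GromovBoundary hX) where
  smul g := Quotient.map (fun x => ⟨fun n => g • x.1 n, x.2.smul g⟩) fun _ _ h => h.smul g
  one_smul := Quotient.ind fun _ =>
    congrArg (Quotient.mk _) (Subtype.ext (funext fun _ => one_smul G _))
  mul_smul g h := Quotient.ind fun _ =>
    congrArg (Quotient.mk _) (Subtype.ext (funext fun _ => mul_smul g h _))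

theorem ConvergesTo.smul (hx : ConvergesTo x ξ) (g : G) :
    ConvergesTo (fun n => g • x n) (g • ξ) := by
  obtain ⟨hx, rfl⟩ := hx
  exact ⟨hx.smul g, rfl⟩

end Action

end Boundary

/-! ### Free subgroups -/

section PingPong

/-- `G` contains a free group of rank two. -/
def ContainsFreeGroup (G : Type*) [Group G] : Prop :=
  ∃ φ : FreeGroup (Fin 2) →* G, Function.Injective φ

variable {G : Type*} [Group G]

theorem ContainsFreeGroup.of_injective {H : Type*} [Group H] (h : ContainsFreeGroup H)
    {f : H →* G} (hf : Function.Injective f) : ContainsFreeGroup G := by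
  obtain ⟨φ, hφ⟩ := h
  exact ⟨f.comp φ, hf.comp hφ⟩

variable {α : Type*}

/-- The image of a signed generator `a i ^ ±1` of a free group, encoded as in `FreeGroup.mk`, where
`true` stands for the exponent `1`. -/
def letter (a : α → G) (p : α × Bool) : G :=
  cond p.2 (a p.1) (a p.1)⁻¹

theorem letter_inv (a : α → G) (p : α × Bool) : (letter a p)⁻¹ = letter a (p.1, !p.2) := by
  rcases p with ⟨i, _ | _⟩ <;> simp [letter]

theorem letter_pow (a : α → G) (n : ℕ) (p : α × Bool) :
    letter (fun i => a i ^ n) p = letter a p ^ n := by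
  rcases p with ⟨i, _ | _⟩ <;> simp [letter]

variable {X : Type*} [MetricSpace X] [MulAction G X] [IsIsometricSMul G X] {δ : ℝ} {o : X}

theorem dist_letter_smul (o : X) (a : α → G) (p : α × Bool) :
    dist o (letter a p • o) = dist o (a p.1 • o) := by
  rcases p with ⟨i, _ | _⟩ <;> simp [letter, dist_inv_smul_self]

namespace IsGromovHyperbolic

/-- A broken geodesic with long pieces and small Gromov products at its corners makes definite
progress; the vertices here are the orbit points of the partial products of `l`. -/
theorem length_le_dist_list_prod (hX : IsGromovHyperbolic δ X) {K : ℝ} (hK : 0 ≤ K) (l : List G)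
    (s : G) (hlong : ∀ t ∈ l, 2 * K + 2 * δ + 1 ≤ dist o (t • o))
    (hcorner : (s :: l).IsChain fun s t => gromovProduct o (s⁻¹ • o) (t • o) ≤ K) :
    gromovProduct o (s⁻¹ • o) (l.prod • o) ≤ K + δ ∧ (l.length : ℝ) ≤ dist o (l.prod • o) := by
  have hδ := hX.nonneg o
  induction l generalizing s with
  | nil =>
    simp only [List.prod_nil, one_smul, gromovProduct_base_right, List.length_nil, Nat.cast_zero,
      dist_self, le_refl, and_true]
    linarith
  | cons t l ih =>
    rw [List.isChain_cons_cons] at hcorner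
    obtain ⟨ih_corner, ih_dist⟩ := ih t (fun u hu => hlong u (List.mem_cons_of_mem _ hu)) hcorner.2
    have ht := hlong t List.mem_cons_self
    have hcorner_t := gromovProduct_smul_mul_smul o t l.prod
    have hdist := dist_mul_smul o t l.prod
    rw [List.prod_cons]
    constructor
    · have hmin := hX o (s⁻¹ • o) ((t * l.prod) • o) (t • o)
      rw [gromovProduct_comm o _ (t • o)] at hmin
      rcases min_le_iff.1 hmin with h | h <;> linarith [hcorner.1]
    · push_cast [List.length_cons]
      linarith

theorem injective_freeGroup_lift (hX : IsGromovHyperbolic δ X) {a : α → G} {K : ℝ} (hK : 0 ≤ K)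
    (hlong : ∀ i, 2 * K + 2 * δ + 1 ≤ dist o (a i • o))
    (hcorner : ∀ p q, p ≠ q → gromovProduct o (letter a p • o) (letter a q • o) ≤ K) :
    Function.Injective (FreeGroup.lift a) := by
  classical
  refine (injective_iff_map_eq_one _).2 fun w hw => FreeGroup.toWord_eq_nil_iff.1 ?_
  have hreduced : FreeGroup.IsReduced w.toWord := FreeGroup.isReduced_toWord
  rw [← FreeGroup.mk_toWord (x := w), FreeGroup.lift_mk] at hw
  cases hword : w.toWord with
  | nil => rfl
  | cons p l =>
    rw [hword] at hw hreduced
    have hchain : (letter a p :: (p :: l).map (letter a)).IsChain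
        fun s t => gromovProduct o (s⁻¹ • o) (t • o) ≤ K := by
      rw [← List.map_cons, List.isChain_map]
      refine (FreeGroup.isReduced_cons_cons.2 ⟨fun _ => rfl, hreduced⟩).imp fun q r hqr => ?_
      rw [letter_inv]
      refine hcorner _ _ ?_
      rintro rfl
      simp at hqr
    have hlength := (hX.length_le_dist_list_prod hK _ _ (o := o) (fun t ht => ?_) hchain).2
    · have hprod : ((p :: l).map (letter a)).prod = 1 := hw
      rw [hprod, one_smul, dist_self, List.length_map, List.length_cons] at hlength
      exact absurd hlength (by positivity : (0 : ℝ) < _).not_ge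
    · obtain ⟨q, -, rfl⟩ := List.mem_map.1 ht
      exact (dist_letter_smul o a q).symm ▸ hlong q.1

theorem exists_injective_lift_pow [Finite α] {hX : IsGromovHyperbolic δ X} (o : X) {a : α → G}
    {ξ : α × Bool → GromovBoundary hX} (hξ : Function.Injective ξ)
    (hlim : ∀ p, ConvergesTo (fun n => letter a p ^ n • o) (ξ p)) :
    ∃ n : ℕ, Function.Injective (FreeGroup.lift fun i => a i ^ n) := by
  have hbound : ∀ r : (α × Bool) × (α × Bool), ∃ K : ℝ, r.1 ≠ r.2 → ∀ᶠ n in atTop,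
      gromovProduct o (letter a r.1 ^ n • o) (letter a r.2 ^ n • o) ≤ K := by
    intro r
    by_cases hr : r.1 = r.2
    · exact ⟨0, fun h => absurd hr h⟩
    · obtain ⟨K, hK⟩ := (hlim r.1).eventually_gromovProduct_le (hlim r.2) (hξ.ne hr) o
      exact ⟨K, fun _ => hK⟩
  choose K hK using hbound
  obtain ⟨M, hM⟩ := Set.finite_range K |>.bddAbove
  have hcorner : ∀ᶠ n in atTop, ∀ p q, p ≠ q →
      gromovProduct o (letter a p ^ n • o) (letter a q ^ n • o) ≤ max M 0 := by
    simp only [eventually_all]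
    exact fun p q hpq => (hK (p, q) hpq).mono fun n hn =>
      hn.trans ((hM ⟨_, rfl⟩).trans (le_max_left _ _))
  have hlong : ∀ᶠ n in atTop, ∀ i, 2 * max M 0 + 2 * δ + 1 ≤ dist o (a i ^ n • o) :=
    eventually_all.2 fun i =>
      (((hlim (i, true)).asymptotic_self).tendsto_dist o).eventually_ge_atTop _
  obtain ⟨n, hn, hn'⟩ := (hcorner.and hlong).exists
  exact ⟨n, hX.injective_freeGroup_lift (le_max_right _ _) hn' fun p q hpq => by
    simpa only [letter_pow] using hn p q hpq⟩

end IsGromovHyperbolic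

end PingPong

/-! ### Loxodromic isometries and fixed points at infinity -/

section Loxodromic

open scoped Pointwise

variable {X : Type*} [MetricSpace X] {δ : ℝ} {o : X}

theorem Asymptotic.of_min_le {x y : ℕ → X} {u v : ℕ → ℝ} {C : ℝ} (hu : Tendsto u atTop atTop)
    (hv : Tendsto v atTop atTop)
    (h : ∀ m n, min (u m) (v n) ≤ 2 * gromovProduct o (x m) (y n) + C) : Asymptotic x y := by
  refine .of_tendsto (o := o) (tendsto_atTop.2 fun B => ?_)
  rw [← prod_atTop_atTop_eq]
  filter_upwards [(hu.eventually_ge_atTop (2 * B + C)).prod_mk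
    (hv.eventually_ge_atTop (2 * B + C))] with n hn
  linarith [h n.1 n.2, le_min hn.1 hn.2]

variable {G : Type*} [Group G] [MulAction G X] [IsIsometricSMul G X] {g h : G}

/-- A quantitative criterion for `g` to act as a loxodromic isometry: the displacement of `o` is
large compared with the backtracking of the orbit at `o`. -/
def IsLoxodromicAt (δ : ℝ) (o : X) (g : G) : Prop :=
  2 * gromovProduct o (g⁻¹ • o) (g • o) + 3 * δ + 1 ≤ dist o (g • o)

namespace IsLoxodromicAt

theorem inv (hg : IsLoxodromicAt δ o g) : IsLoxodromicAt δ o g⁻¹ := by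
  rwa [IsLoxodromicAt, inv_inv, gromovProduct_comm, dist_inv_smul_self]

theorem gromovProduct_pow_le_and_le_dist (hX : IsGromovHyperbolic δ X) (hg : IsLoxodromicAt δ o g)
    (n : ℕ) :
    gromovProduct o (g⁻¹ • o) (g ^ n • o) ≤ gromovProduct o (g⁻¹ • o) (g • o) + δ ∧
      (n : ℝ) ≤ dist o (g ^ n • o) := by
  have hlong : 2 * gromovProduct o (g⁻¹ • o) (g • o) + 2 * δ + 1 ≤ dist o (g • o) := by
    rw [IsLoxodromicAt] at hg
    linarith [hX.nonneg o]
  have hchain : (g :: List.replicate n g).IsChain fun s t =>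
      gromovProduct o (s⁻¹ • o) (t • o) ≤ gromovProduct o (g⁻¹ • o) (g • o) :=
    List.replicate_succ (n := n) (a := g) ▸ List.isChain_replicate_of_rel _ le_rfl
  simpa only [List.prod_replicate, List.length_replicate] using
    hX.length_le_dist_list_prod (gromovProduct_nonneg _ _ _) _ g
      (fun t ht => List.eq_of_mem_replicate ht ▸ hlong) hchain

theorem gromovProduct_inv_pow_pow_le (hX : IsGromovHyperbolic δ X) (hg : IsLoxodromicAt δ o g)
    (m n : ℕ) :
    gromovProduct o (g⁻¹ ^ m • o) (g ^ n • o) ≤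
      gromovProduct o (g⁻¹ • o) (g • o) + 2 * δ := by
  have hδ := hX.nonneg o
  cases m with
  | zero =>
    rw [pow_zero, one_smul, gromovProduct_base_left]
    linarith [gromovProduct_nonneg o (g⁻¹ • o) (g • o)]
  | succ m =>
    have hpow := (hg.gromovProduct_pow_le_and_le_dist hX n).1
    have hpow_inv := (hg.inv.gromovProduct_pow_le_and_le_dist hX m).1
    rw [inv_inv, gromovProduct_comm o (g • o) (g⁻¹ • o)] at hpow_inv
    have hsucc := gromovProduct_smul_mul_smul o g⁻¹ (g⁻¹ ^ m)
    rw [inv_inv, ← pow_succ', dist_inv_smul_self] at hsucc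
    rw [IsLoxodromicAt] at hg
    rcases min_le_iff.1 (hX o (g⁻¹ • o) (g⁻¹ ^ (m + 1) • o) (g ^ n • o)) with h | h <;> linarith

theorem min_le_gromovProduct_pow (hX : IsGromovHyperbolic δ X) (hg : IsLoxodromicAt δ o g)
    (m n : ℕ) :
    min (m : ℝ) n ≤ gromovProduct o (g ^ m • o) (g ^ n • o) +
      (gromovProduct o (g⁻¹ • o) (g • o) + 2 * δ) := by
  wlog hmn : m ≤ n generalizing m n
  · rw [min_comm, gromovProduct_comm]
    exact this n m (le_of_not_ge hmn)
  obtain ⟨k, rfl⟩ := Nat.exists_eq_add_of_le hmn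
  have hprod := gromovProduct_smul_mul_smul o (g ^ m) (g ^ k)
  rw [← pow_add, ← inv_pow] at hprod
  linarith [min_le_left (m : ℝ) ↑(m + k), (hg.gromovProduct_pow_le_and_le_dist hX m).2,
    hg.gromovProduct_inv_pow_pow_le hX m k]

theorem asymptotic_pow (hX : IsGromovHyperbolic δ X) (hg : IsLoxodromicAt δ o g) :
    Asymptotic (fun n => g ^ n • o) fun n => g ^ n • o :=
  .of_min_le (o := o) (C := gromovProduct o (g⁻¹ • o) (g • o) + 2 * δ)
    tendsto_natCast_atTop_atTop tendsto_natCast_atTop_atTop fun m n =>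
    (hg.min_le_gromovProduct_pow hX m n).trans
      (by linarith [gromovProduct_nonneg o (g ^ m • o) (g ^ n • o)])

theorem exists_convergesTo (hX : IsGromovHyperbolic δ X) (hg : IsLoxodromicAt δ o g) :
    ∃ ξ η : GromovBoundary hX, ξ ≠ η ∧ ConvergesTo (fun n => g ^ n • o) ξ ∧
      ConvergesTo (fun n => g⁻¹ ^ n • o) η := by
  obtain ⟨ξ, hξ⟩ := (hg.asymptotic_pow hX).exists_convergesTo hX
  obtain ⟨η, hη⟩ := (hg.inv.asymptotic_pow hX).exists_convergesTo hX
  refine ⟨ξ, η, fun h => ?_, hξ, hη⟩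
  have hlim := ((hη.asymptotic_iff hξ).2 h.symm).tendsto_diagonal o
  obtain ⟨n, hn⟩ := (hlim.eventually_gt_atTop _).exists
  exact (hg.gromovProduct_inv_pow_pow_le hX n n).not_gt hn

end IsLoxodromicAt

variable {hX : IsGromovHyperbolic δ X} {ξ η : GromovBoundary hX}

theorem ConvergesTo.conj_pow_smul (hg : ConvergesTo (fun n => g ^ n • o) ξ) (h : G) :
    ConvergesTo (fun n => (h * g * h⁻¹) ^ n • o) (h • ξ) := by
  refine (hg.smul h).of_asymptotic
    ((hg.smul h).asymptotic_self.trans_dist_le (C := dist o (h⁻¹ • o)) fun n => ?_)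
  rw [conj_pow, mul_smul, mul_smul, dist_smul, dist_smul]

theorem containsFreeGroup_of_disjoint (hne : ξ ≠ η) (hξ : ConvergesTo (fun n => g ^ n • o) ξ)
    (hη : ConvergesTo (fun n => g⁻¹ ^ n • o) η)
    (hdisj : Disjoint (h • ({ξ, η} : Set (GromovBoundary hX))) {ξ, η}) : ContainsFreeGroup G := by
  let c : Fin 2 → G := ![1, h]
  let ζ : Bool → GromovBoundary hX := fun b => cond b ξ η
  have hζ : Function.Injective ζ := by
    rintro (_ | _) (_ | _) <;> simp [ζ, hne, hne.symm]
  have hζ_mem : ∀ b, ζ b ∈ ({ξ, η} : Set (GromovBoundary hX)) := by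
    rintro (_ | _) <;> simp [ζ]
  have hhζ : ∀ b b', h • ζ b ≠ ζ b' := fun b b' heq =>
    Set.disjoint_left.1 hdisj (Set.smul_mem_smul_set (hζ_mem b)) (heq ▸ hζ_mem b')
  have hinj : Function.Injective fun p : Fin 2 × Bool => c p.1 • ζ p.2 := by
    rintro ⟨i, b⟩ ⟨j, b'⟩ heq
    fin_cases i <;> fin_cases j
    · simpa [c, hζ.eq_iff] using heq
    · exact absurd (by simpa [c] using heq.symm) (hhζ b' b)
    · exact absurd (by simpa [c] using heq) (hhζ b b')
    · simpa [c, hζ.eq_iff] using heq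
  have hlim : ∀ p : Fin 2 × Bool,
      ConvergesTo (fun n => letter (fun i => c i * g * (c i)⁻¹) p ^ n • o) (c p.1 • ζ p.2) := by
    rintro ⟨i, _ | _⟩
    · simpa only [letter, ζ, cond_false, mul_inv_rev, inv_inv, mul_assoc]
        using hη.conj_pow_smul (c i)
    · exact hξ.conj_pow_smul (c i)
  obtain ⟨n, hn⟩ := IsGromovHyperbolic.exists_injective_lift_pow o hinj hlim
  exact ⟨_, hn⟩

/-- By B. H. Neumann's lemma, as finitely many cosets of the stabilizers of the points of `F`
cover `G`. -/
theorem exists_finiteIndex_stabilizer {G α : Type*} [Group G] [MulAction G α] {F : Set α}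
    (hF : F.Finite) (hG : ∀ g : G, ¬ Disjoint (g • F) F) :
    ∃ x ∈ F, (MulAction.stabilizer G x).FiniteIndex := by
  have hcoset : ∀ p : α × α, ∃ c : G, ∀ g : G, g • p.1 = p.2 →
      g ∈ c • (MulAction.stabilizer G p.1 : Set G) := by
    rintro ⟨x, y⟩
    by_cases hxy : ∃ c : G, c • x = y
    · obtain ⟨c, rfl⟩ := hxy
      refine ⟨c, fun g hg => Set.mem_smul_set_iff_inv_smul_mem.2 ?_⟩
      rw [SetLike.mem_coe, MulAction.mem_stabilizer_iff, smul_eq_mul, mul_smul, hg, inv_smul_smul]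
    · exact ⟨1, fun g hg => absurd ⟨g, hg⟩ hxy⟩
  choose c hc using hcoset
  have hcover : ⋃ p ∈ (hF.prod hF).toFinset, c p • (MulAction.stabilizer G p.1 : Set G) =
      Set.univ := by
    refine Set.eq_univ_of_forall fun g => ?_
    obtain ⟨_, ⟨x, hx, rfl⟩, hgx⟩ := Set.not_disjoint_iff.1 (hG g)
    exact Set.mem_biUnion ((hF.prod hF).mem_toFinset.2 ⟨hx, hgx⟩) (hc (x, g • x) g rfl)
  obtain ⟨p, hp, hfin⟩ := Subgroup.exists_finiteIndex_of_leftCoset_cover hcover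
  exact ⟨p.1, ((hF.prod hF).mem_toFinset.1 hp).1, hfin⟩

theorem isLoxodromicAt_mul (hX : IsGromovHyperbolic δ X) (hg : ¬ IsLoxodromicAt δ o g)
    (hh : ¬ IsLoxodromicAt δ o h)
    (hg_far : 2 * gromovProduct o (g • o) (h • o) + 8 * δ + 1 < dist o (g • o))
    (hh_far : 2 * gromovProduct o (g • o) (h • o) + 8 * δ + 1 < dist o (h • o)) :
    IsLoxodromicAt δ o (g * h) := by
  have hδ := hX.nonneg o
  rw [IsLoxodromicAt, not_le] at hg hh
  rw [IsLoxodromicAt]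
  set p := gromovProduct o (g • o) (h • o)
  have : 0 ≤ p := gromovProduct_nonneg _ _ _
  have hleft : gromovProduct o (g⁻¹ • o) (h • o) ≤ p + δ := by
    have hmin := hX o (g • o) (g⁻¹ • o) (h • o)
    rw [gromovProduct_comm o (g • o) (g⁻¹ • o)] at hmin
    rcases min_le_iff.1 hmin with h | h <;> linarith
  have hright : gromovProduct o (g • o) (h⁻¹ • o) ≤ p + δ := by
    rcases min_le_iff.1 (hX o (g • o) (h⁻¹ • o) (h • o)) with h | h <;> linarith
  have hdist := dist_mul_smul o g h
  have hgp := gromovProduct_smul_mul_smul o g h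
  have hgp_inv := gromovProduct_smul_mul_smul o h⁻¹ g⁻¹
  rw [inv_inv, ← mul_inv_rev, dist_inv_smul_self, gromovProduct_comm o (h • o)] at hgp_inv
  have hback : gromovProduct o ((g * h)⁻¹ • o) ((g * h) • o) ≤ p + 3 * δ := by
    have hmin := hX o (g • o) ((g * h) • o) (h⁻¹ • o)
    have hmin' := hX o ((g * h) • o) ((g * h)⁻¹ • o) (h⁻¹ • o)
    rw [gromovProduct_comm o _ (h⁻¹ • o), gromovProduct_comm o ((g * h) • o)] at hmin'
    rw [gromovProduct_comm o ((g * h) • o) (h⁻¹ • o)] at hmin hmin'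
    rcases min_le_iff.1 hmin with h | h <;> rcases min_le_iff.1 hmin' with h' | h' <;> linarith
  linarith

theorem exists_forall_smul_eq_of_not_isLoxodromicAt (hX : IsGromovHyperbolic δ X)
    (hlox : ∀ g : G, ¬ IsLoxodromicAt δ o g)
    (hunb : ¬ Bornology.IsBounded (MulAction.orbit G o)) :
    ∃ ξ : GromovBoundary hX, ∀ g : G, g • ξ = ξ := by
  have hmin : ∀ g h : G, min (dist o (g • o)) (dist o (h • o)) ≤
      2 * gromovProduct o (g • o) (h • o) + (8 * δ + 1) := by
    intro g h
    by_contra! hfar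
    obtain ⟨hg, hh⟩ := lt_min_iff.1 hfar
    exact hlox _ (isLoxodromicAt_mul hX (hlox g) (hlox h) (by linarith) (by linarith))
  have hfar : ∀ n : ℕ, ∃ g : G, n ≤ dist o (g • o) := by
    by_contra! hcon
    obtain ⟨n, hn⟩ := hcon
    refine hunb ((Metric.isBounded_iff_subset_closedBall o).2 ⟨n, ?_⟩)
    rintro _ ⟨g, rfl⟩
    exact Metric.mem_closedBall'.2 (hn g).le
  choose u hu using hfar
  have hu_lim : Tendsto (fun n => dist o (u n • o)) atTop atTop :=
    tendsto_atTop_mono hu tendsto_natCast_atTop_atTop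
  obtain ⟨ξ, hξ⟩ := (Asymptotic.of_min_le hu_lim hu_lim fun m n =>
    hmin (u m) (u n)).exists_convergesTo hX
  refine ⟨ξ, fun g => ((hξ.smul g).asymptotic_iff hξ).1 ?_⟩
  have hgu_lim : Tendsto (fun n => dist o ((g * u n) • o)) atTop atTop := by
    refine tendsto_atTop_mono (fun n => ?_)
      (tendsto_atTop_add_const_right _ (-dist o (g • o)) hu_lim)
    have htri := dist_triangle (g • o) o ((g * u n) • o)
    rw [mul_smul, dist_smul, dist_comm (g • o), ← mul_smul] at htri
    linarith
  simpa only [mul_smul] using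
    Asymptotic.of_min_le hgu_lim hu_lim fun m n => hmin (g * u m) (u n)

theorem containsFreeGroup_or_exists_finiteIndex_stabilizer (hX : IsGromovHyperbolic δ X)
    (hunb : ¬ Bornology.IsBounded (MulAction.orbit G o)) :
    ContainsFreeGroup G ∨
      ∃ ξ : GromovBoundary hX, (MulAction.stabilizer G ξ).FiniteIndex := by
  by_cases hlox : ∃ g : G, IsLoxodromicAt δ o g
  · obtain ⟨g, hg⟩ := hlox
    obtain ⟨ξ, η, hne, hξ, hη⟩ := hg.exists_convergesTo hX
    refine or_iff_not_imp_left.2 fun hfree => ?_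
    obtain ⟨ζ, -, hζ⟩ := exists_finiteIndex_stabilizer (Set.toFinite {ξ, η}) fun h hdisj =>
      hfree (containsFreeGroup_of_disjoint hne hξ hη hdisj)
    exact ⟨ζ, hζ⟩
  · push Not at hlox
    obtain ⟨ξ, hξ⟩ := exists_forall_smul_eq_of_not_isLoxodromicAt hX hlox hunb
    have htop : MulAction.stabilizer G ξ = ⊤ := eq_top_iff.2 fun g _ => hξ g
    exact .inr ⟨ξ, htop ▸ inferInstance⟩

end Loxodromic

/-! ### Horofunctions -/

section Horofunction

/-- A real function on a group that is additive up to the error `C`. -/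
def IsQuasimorphism {G : Type*} [Group G] (f : G → ℝ) (C : ℝ) : Prop :=
  ∀ g h, |f (g * h) - f g - f h| ≤ C

variable {X : Type*} [MetricSpace X] {δ : ℝ} {o : X} {x : ℕ → X}

/-- The horofunction of the sequence `x`, normalised to vanish at `o`. The limit is taken along an
ultrafilter since it need not exist along `atTop`. -/
noncomputable def horofunction (o : X) (x : ℕ → X) (a : X) : ℝ :=
  limUnder (hyperfilter ℕ : Filter ℕ) fun n => dist a (x n) - dist o (x n)

theorem tendsto_horofunction (o : X) (x : ℕ → X) (a : X) :
    Tendsto (fun n => dist a (x n) - dist o (x n)) (hyperfilter ℕ : Filter ℕ)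
      (𝓝 (horofunction o x a)) := by
  have hmem : ∀ n, dist a (x n) - dist o (x n) ∈ Set.Icc (-dist a o) (dist a o) := fun n =>
    abs_le.1 (abs_dist_sub_le a o (x n))
  obtain ⟨r, -, hr⟩ := (isCompact_Icc (a := -dist a o) (b := dist a o)).ultrafilter_le_nhds
    ((hyperfilter ℕ).map _) (tendsto_principal.2 (.of_forall hmem))
  exact tendsto_nhds_limUnder ⟨r, hr⟩

theorem horofunction_self (o : X) (x : ℕ → X) : horofunction o x o = 0 :=
  tendsto_nhds_unique (tendsto_horofunction o x o) (by simp only [sub_self, tendsto_const_nhds])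

theorem dist_add_horofunction_le (hX : IsGromovHyperbolic δ X) (o : X) (x : ℕ → X) (a b c : X) :
    dist a b + horofunction o x c ≤
      max (dist a c + horofunction o x b) (dist b c + horofunction o x a) + 2 * δ := by
  have hlim := tendsto_horofunction o x
  refine le_of_tendsto_of_tendsto' (tendsto_const_nhds.add (hlim c))
    (((tendsto_const_nhds.add (hlim b)).max (tendsto_const_nhds.add (hlim a))).add_const (2 * δ))
    fun n => ?_
  have hfour := hX.dist_add_dist_le a b c (x n)
  rw [add_comm (dist a (x n))] at hfour
  simp only [← add_sub_assoc, max_sub_sub_right]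
  linarith

theorem abs_horofunction_smul_sub_le {G : Type*} [Group G] [MulAction G X] [IsIsometricSMul G X]
    (hX : IsGromovHyperbolic δ X) {g : G} (hg : Asymptotic (fun n => g • x n) x) (a b : X) :
    |horofunction o x (g • a) - horofunction o x (g • b) -
      (horofunction o x a - horofunction o x b)| ≤ 2 * δ := by
  have hlim := tendsto_horofunction o x
  refine le_of_tendsto (((hlim (g • a)).sub (hlim (g • b))).sub ((hlim a).sub (hlim b))).abs
    (Nat.hyperfilter_le_atTop ?_)
  filter_upwards [(hg.symm.tendsto_diagonal o).eventually_gt_atTop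
    ((dist (g • a) (g • b) + dist o (g • a) + dist o (g • b) + 2 * δ) / 2)] with n hn
  have hdist := hX.abs_dist_sub_dist_sub_le (o := o) ((div_lt_iff₀' two_pos).1 hn)
  rwa [dist_smul, dist_smul, ← sub_sub_sub_cancel_right (dist (g • a) (x n)) _ (dist o (x n)),
    ← sub_sub_sub_cancel_right (dist a (x n)) _ (dist o (x n))] at hdist

/-- The points are found on geodesics towards the terms of `x`, which fellow travel for longer and
longer. -/
theorem exists_dist_eq_and_horofunction_le (hX : IsHyperbolicSpace δ X) (hx : Asymptotic x x)
    (o : X) {s : ℝ} (hs : 0 ≤ s) : ∃ y, dist o y = s ∧ horofunction o x y ≤ -s + δ := by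
  obtain ⟨N, hN⟩ := hx.exists_forall_ge o s
  have hs_le : ∀ n ≥ N, s ≤ dist o (x n) := fun n hn =>
    (hN n hn n hn).trans (gromovProduct_le_dist_left _ _ _)
  obtain ⟨γ, hγ⟩ := hX.1 o (x N)
  refine ⟨γ s, hγ.dist_left ⟨hs, hs_le N le_rfl⟩, le_of_tendsto (tendsto_horofunction o x _)
    (Nat.hyperfilter_le_atTop ?_)⟩
  filter_upwards [eventually_ge_atTop N] with n hn
  obtain ⟨η, hη⟩ := hX.1 o (x n)
  have hfellow : dist (γ s) (η s) ≤ δ := hX.2 o (x N) (x n) γ η hγ hη s ⟨hs, hN N le_rfl n hn⟩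
  have hη_right := hη.dist_right ⟨hs, hs_le n hn⟩
  linarith [dist_triangle (γ s) (η s) (x n)]

variable {G : Type*} [Group G] [MulAction G X]

/-- Every element `g` moves all but finitely many points of the sequence `y` by at most `|f g|`,
up to a uniform error. -/
def ControlsDisplacement (f : G → ℝ) (C : ℝ) (y : ℕ → X) : Prop :=
  ∀ g, ∀ᶠ n in atTop, dist (g • y n) (y n) ≤ |f g| + C

theorem exists_controlsDisplacement_of_isBounded (hb : Bornology.IsBounded (MulAction.orbit G o)) :
    ∃ C : ℝ, ControlsDisplacement (0 : G → ℝ) C fun _ => o := by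
  obtain ⟨C, hC⟩ := (Metric.isBounded_iff_subset_closedBall o).1 hb
  refine ⟨C, fun g => .of_forall fun _ => ?_⟩
  simpa only [Pi.zero_apply, abs_zero, zero_add] using
    Metric.mem_closedBall.1 (hC (MulAction.mem_orbit o g))

variable [IsIsometricSMul G X]

theorem isQuasimorphism_horofunction (hX : IsGromovHyperbolic δ X)
    (hG : ∀ g : G, Asymptotic (fun n => g • x n) x) :
    IsQuasimorphism (fun g : G => horofunction o x (g • o)) (2 * δ) := fun g h => by
  simpa only [horofunction_self, sub_zero, mul_smul] using
    abs_horofunction_smul_sub_le (o := o) hX (hG g) (h • o) o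

theorem dist_smul_le_abs_horofunction_add (hX : IsGromovHyperbolic δ X) {g : G}
    (hg : Asymptotic (fun n => g • x n) x) {y : X} (hy : horofunction o x y ≤ -dist o y + δ)
    (hy_far : |horofunction o x (g • o)| + dist o (g • o) + 3 * δ ≤ dist o y) :
    dist (g • y) y ≤ |horofunction o x (g • o)| + 5 * δ := by
  have hδ := hX.nonneg o
  have hfour_o := dist_add_horofunction_le hX o x (g • y) o (g • o)
  have hfour_y := dist_add_horofunction_le hX o x (g • y) y o
  have hquasi := (abs_le.1 (abs_horofunction_smul_sub_le (o := o) hX hg y o)).2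
  rw [horofunction_self, dist_smul, dist_comm y] at hfour_o
  rw [horofunction_self, dist_comm y o] at hfour_y
  rw [horofunction_self] at hquasi
  set β := horofunction o x
  have hβ_neg := neg_abs_le (β (g • o))
  have hβ_le := le_abs_self (β (g • o))
  have hβ_gy : β (g • y) ≤ β (g • o) - dist o y + 3 * δ := by linarith
  have hgy : dist (g • y) o ≤ dist o y - β (g • o) + 2 * δ := by
    rcases max_cases (dist o y + 0) (dist o (g • o) + β (g • y)) with ⟨h, -⟩ | ⟨h, -⟩ <;>
      linarith [hβ_gy, dist_nonneg (x := o) (y := y)]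
  rcases max_cases (dist (g • y) o + β y) (dist o y + β (g • y)) with ⟨h, -⟩ | ⟨h, -⟩ <;>
    linarith [hδ]

theorem exists_controlsDisplacement_of_forall_smul_eq (hX : IsHyperbolicSpace δ X) (o : X)
    {ξ : GromovBoundary hX.isGromovHyperbolic} (hξ : ∀ g : G, g • ξ = ξ) :
    ∃ (f : G → ℝ) (C C' : ℝ) (y : ℕ → X), IsQuasimorphism f C ∧ ControlsDisplacement f C' y ∧
      Tendsto y atTop (Bornology.cobounded X) := by
  obtain ⟨x, hx⟩ := ξ.exists_convergesTo
  have hG : ∀ g : G, Asymptotic (fun n => g • x n) x := fun g =>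
    ((hx.smul g).asymptotic_iff hx).2 (hξ g)
  choose y hy_dist hy using fun n : ℕ =>
    exists_dist_eq_and_horofunction_le hX hx.asymptotic_self o n.cast_nonneg
  refine ⟨fun g => horofunction o x (g • o), 2 * δ, 5 * δ, y,
    isQuasimorphism_horofunction hX.isGromovHyperbolic hG, fun g => ?_, ?_⟩
  · filter_upwards [tendsto_natCast_atTop_atTop.eventually_ge_atTop
      (|horofunction o x (g • o)| + dist o (g • o) + 3 * δ)] with n hn
    exact dist_smul_le_abs_horofunction_add hX.isGromovHyperbolic (hG g)
      (by rw [hy_dist]; exact hy n) (by rwa [hy_dist])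
  · rw [← Metric.comap_dist_left_atTop o, tendsto_comap_iff]
    exact tendsto_natCast_atTop_atTop.congr fun n => (hy_dist n).symm

end Horofunction

/-! ### Quasimorphisms -/

section Quasimorphism

open scoped commutatorElement

variable {G : Type*} [Group G] {f : G → ℝ} {C : ℝ}

/-- The homogenization `lim f (g ^ m) / m` of a quasimorphism `f`, taken along the powers of two. -/
noncomputable def homogenization (f : G → ℝ) (g : G) : ℝ :=
  limUnder atTop fun n : ℕ => f (g ^ 2 ^ n) / 2 ^ n

namespace IsQuasimorphism

theorem dist_pow_two_pow_div_le (hf : IsQuasimorphism f C) (g : G) (n : ℕ) :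
    dist (f (g ^ 2 ^ n) / 2 ^ n) (f (g ^ 2 ^ (n + 1)) / 2 ^ (n + 1)) ≤ C / 2 / 2 ^ n := by
  have hsq := hf (g ^ 2 ^ n) (g ^ 2 ^ n)
  rw [← pow_add, ← two_mul, ← pow_succ'] at hsq
  calc dist (f (g ^ 2 ^ n) / 2 ^ n) (f (g ^ 2 ^ (n + 1)) / 2 ^ (n + 1))
      = ‖(f (g ^ 2 ^ (n + 1)) - f (g ^ 2 ^ n) - f (g ^ 2 ^ n)) / 2 / 2 ^ n‖ := by
        rw [dist_comm, dist_eq_norm]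
        congr 1
        field_simp
        ring
    _ = |f (g ^ 2 ^ (n + 1)) - f (g ^ 2 ^ n) - f (g ^ 2 ^ n)| / 2 / 2 ^ n := by
        rw [norm_div, norm_div, norm_pow, Real.norm_two, Real.norm_eq_abs]
    _ ≤ C / 2 / 2 ^ n := by gcongr

theorem tendsto_homogenization (hf : IsQuasimorphism f C) (g : G) :
    Tendsto (fun n : ℕ => f (g ^ 2 ^ n) / 2 ^ n) atTop (𝓝 (homogenization f g)) :=
  tendsto_nhds_limUnder (cauchySeq_tendsto_of_complete
    (cauchySeq_of_le_geometric_two (hf.dist_pow_two_pow_div_le g)))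

theorem abs_sub_homogenization_le (hf : IsQuasimorphism f C) (g : G) :
    |f g - homogenization f g| ≤ C := by
  simpa only [Real.dist_eq, pow_zero, pow_one, div_one] using
    dist_le_of_le_geometric_two_of_tendsto₀ (hf.dist_pow_two_pow_div_le g)
      (hf.tendsto_homogenization g)

theorem abs_commutatorElement_le (hf : IsQuasimorphism f C) (a b : G) : |f ⁅a, b⁆| ≤ 7 * C := by
  have h_one := hf 1 1
  have h_a := hf a a⁻¹
  have h_b := hf b b⁻¹
  have h_ab := hf a b
  have h_aba := hf (a * b) a⁻¹
  have h_comm := hf (a * b * a⁻¹) b⁻¹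
  rw [mul_one] at h_one
  rw [mul_inv_cancel] at h_a h_b
  rw [commutatorElement_def]
  simp only [abs_le] at *
  constructor <;> linarith

/-- `(a * b) ^ m` and `a ^ m * b ^ m` differ by an element of the commutator subgroup, so their
images under `f` stay at bounded distance as `m` grows. -/
theorem homogenization_mul (hf : IsQuasimorphism f C) {M : ℝ}
    (hM : ∀ c ∈ commutator G, |f c| ≤ M) (a b : G) :
    homogenization f (a * b) = homogenization f a + homogenization f b := by
  have hbound : ∀ m : ℕ, |f ((a * b) ^ m) - f (a ^ m) - f (b ^ m)| ≤ 2 * C + M := fun m => by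
    have hmem : (a ^ m * b ^ m)⁻¹ * (a * b) ^ m ∈ commutator G := by
      rw [← Abelianization.ker_of, MonoidHom.mem_ker]
      simp only [map_mul, map_inv, map_pow, mul_pow, inv_mul_cancel]
    have h_comm := hf (a ^ m * b ^ m) ((a ^ m * b ^ m)⁻¹ * (a * b) ^ m)
    rw [mul_inv_cancel_left] at h_comm
    have h_mul := hf (a ^ m) (b ^ m)
    have h_small := hM _ hmem
    simp only [abs_le] at *
    constructor <;> linarith
  have hzero : Tendsto (fun n : ℕ => (2 * C + M) / 2 ^ n) atTop (𝓝 0) :=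
    tendsto_const_nhds.div_atTop (tendsto_pow_atTop_atTop_of_one_lt one_lt_two)
  have hlim := ((hf.tendsto_homogenization (a * b)).sub (hf.tendsto_homogenization a)).sub
    (hf.tendsto_homogenization b)
  refine sub_eq_iff_eq_add'.1 (sub_eq_zero.1 (tendsto_nhds_unique hlim
    (squeeze_zero_norm (fun n => ?_) hzero)))
  rw [← sub_div, ← sub_div, norm_div, norm_pow, Real.norm_two]
  gcongr
  exact hbound _

end IsQuasimorphism

/-- The image of `F` is a discrete subgroup of `E`, hence a lattice in the subspace it spans. -/
theorem exists_surjective_int_hom_of_finite_preimages {E : Type*} [NormedAddCommGroup E]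
    [NormedSpace ℝ E] [FiniteDimensional ℝ E] (F : G →* Multiplicative E)
    (hF : ∀ B : ℝ, {g | ‖(F g).toAdd‖ ≤ B}.Finite) :
    ∃ k ≤ Module.finrank ℝ E, ∃ ψ : G →* Multiplicative (Fin k → ℤ),
      Function.Surjective ψ ∧ Finite ψ.ker := by
  let L : Submodule ℤ E := (Subgroup.toAddSubgroup' F.range).toIntSubmodule
  have hdisc : DiscreteTopology L := by
    refine discreteTopology_of_isOpen_singleton_zero (isOpen_singleton_of_finite_mem_nhds 0
      (Metric.closedBall_mem_nhds (0 : L) one_pos) (Set.Finite.of_finite_image (f := Subtype.val)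
        (((hF 1).image fun g => (F g).toAdd).subset ?_) Subtype.val_injective.injOn))
    rintro _ ⟨⟨_, g, hg⟩, hg_le, rfl⟩
    exact ⟨g, (congrArg norm hg).trans_le (mem_closedBall_zero_iff.1 hg_le), hg⟩
  have hrank : Module.finrank ℤ L ≤ Module.finrank ℝ E := by
    have hspan := Real.finrank_eq_int_finrank_of_discrete (s := (L : Set E))
      (by rwa [Submodule.span_eq])
    rw [Set.finrank, Set.finrank, Submodule.span_eq] at hspan
    exact hspan ▸ Submodule.finrank_le _
  let e : Multiplicative L ≃* Multiplicative (Fin (Module.finrank ℤ L) → ℤ) :=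
    (Module.finBasis ℤ L).equivFun.toAddEquiv.toMultiplicative
  let toL : F.range ≃* Multiplicative L := MulEquiv.refl _
  refine ⟨_, hrank, (toL.trans e).toMonoidHom.comp F.rangeRestrict,
    (toL.trans e).surjective.comp F.rangeRestrict_surjective, ?_⟩
  refine (hF 0).subset fun g hg => ?_
  have hFg : F g = 1 := congrArg Subtype.val
    ((MulEquiv.map_eq_one_iff (toL.trans e)).1 (MonoidHom.mem_ker.1 hg))
  rw [Set.mem_ofPred_eq, hFg, toAdd_one, norm_zero]

theorem exists_surjective_int_hom_of_quasimorphisms {ι : Type*} [Fintype ι] {f : ι → G → ℝ}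
    {C : ι → ℝ} (hf : ∀ i, IsQuasimorphism (f i) (C i))
    (hfin : ∀ B : ι → ℝ, {g | ∀ i, |f i g| ≤ B i}.Finite) :
    ∃ k ≤ Fintype.card ι, ∃ ψ : G →* Multiplicative (Fin k → ℤ),
      Function.Surjective ψ ∧ Finite ψ.ker := by
  have : Finite (commutatorSet G) := (hfin fun i => 7 * C i).subset <| by
    rintro _ ⟨a, b, rfl⟩ i
    exact (hf i).abs_commutatorElement_le a b
  have hcomm : ∀ i, ∃ M, ∀ c ∈ commutator G, |f i c| ≤ M := fun i =>
    let ⟨M, hM⟩ := (Set.finite_range fun c : commutator G => |f i c|).bddAbove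
    ⟨M, fun c hc => hM ⟨⟨c, hc⟩, rfl⟩⟩
  choose M hM using hcomm
  let F : G →* Multiplicative (ι → ℝ) :=
    MonoidHom.mk' (fun g => .ofAdd fun i => homogenization (f i) g) fun a b =>
      congrArg Multiplicative.ofAdd (funext fun i => (hf i).homogenization_mul (hM i) a b)
  rw [← Module.finrank_fintype_fun_eq_card ℝ]
  refine exists_surjective_int_hom_of_finite_preimages F fun B =>
    (hfin fun i => B + C i).subset fun g hg i => ?_
  have hF : |homogenization (f i) g| ≤ B := (norm_le_pi_norm (F g).toAdd i).trans hg
  have hdist := (hf i).abs_sub_homogenization_le g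
  simp only [abs_le] at *
  constructor <;> linarith

end Quasimorphism

namespace VirtuallyIsomorphic

variable {G A : Type*} [Group G] [Group A]

theorem of_surjective (ψ : G →* A) (hψ : Function.Surjective ψ) [Finite ψ.ker] :
    VirtuallyIsomorphic G A := by
  let ψ' : (⊤ : Subgroup G) →* A := ψ.comp Subgroup.topEquiv.toMonoidHom
  have hker : Finite ψ'.ker :=
    Finite.of_injective (fun g => (⟨g, g.2⟩ : ψ.ker)) fun _ _ h =>
      Subtype.ext (Subtype.ext (congrArg (fun g : ψ.ker => (g : G)) h))
  exact ⟨⊤, ⊤, ψ'.ker, ⊥, inferInstance, inferInstance, inferInstance, inferInstance, hker,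
    inferInstance,
    ⟨(QuotientGroup.quotientKerEquivOfSurjective ψ' (hψ.comp Subgroup.topEquiv.surjective)).trans
      (Subgroup.topEquiv.symm.trans QuotientGroup.quotientBot.symm)⟩⟩

theorem of_finiteIndex {H : Subgroup G} [H.FiniteIndex] (h : VirtuallyIsomorphic H A) :
    VirtuallyIsomorphic G A := by
  obtain ⟨H', A', K, L, hK, hL, hH', hA', hKfin, hLfin, ⟨e⟩⟩ := h
  let i : H' ≃* H'.map H.subtype := H'.equivMapOfInjective _ H.subtype_injective
  have hnormal : (K.map (i : H' →* H'.map H.subtype)).Normal := hK.map _ i.surjective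
  have hindex : (H'.map H.subtype).FiniteIndex := by
    rw [Subgroup.finiteIndex_iff, Subgroup.index_map_subtype]
    exact mul_ne_zero hH'.index_ne_zero Subgroup.FiniteIndex.index_ne_zero
  exact ⟨_, A', _, L, hnormal, hL, hindex, hA',
    Finite.of_equiv _ (i.subgroupMap K).toEquiv, hLfin,
    ⟨(QuotientGroup.congr K _ i rfl).symm.trans e⟩⟩

end VirtuallyIsomorphic

section Actions

variable {G Y : Type*} [Group G] [MetricSpace Y] {ρ : G →* (Y ≃ᵢ Y)}

theorem IsAcylindrical.comp_of_injective {H : Type*} [Group H] {φ : H →* G}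
    (hφ : Function.Injective φ) (hρ : IsAcylindrical ρ) : IsAcylindrical (ρ.comp φ) := by
  intro ε hε
  obtain ⟨R, N, hR, hN⟩ := hρ ε hε
  refine ⟨R, N, hR, fun x y hxy => le_trans ?_ (hN x y hxy)⟩
  rw [← hφ.encard_image]
  exact Set.encard_le_encard (Set.image_subset_iff.2 fun _ hg => hg)

/-- Any finitely many elements of `S` simultaneously move two far apart terms of `y` by at most
`ε`. -/
theorem IsAcylindrical.finite_of_eventually_dist_le (hρ : IsAcylindrical ρ) {y : ℕ → Y}
    (hy : Tendsto y atTop (Bornology.cobounded Y)) {ε : ℝ} {S : Set G}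
    (hS : ∀ g ∈ S, ∀ᶠ n in atTop, dist (ρ g (y n)) (y n) ≤ ε) : S.Finite := by
  obtain ⟨R, N, -, hN⟩ := hρ (max ε 1) (by positivity)
  by_contra hinf
  obtain ⟨t, htS, ht_card⟩ := Set.Infinite.exists_subset_card_eq hinf (N + 1)
  obtain ⟨n, hn⟩ := eventually_atTop.1
    ((Filter.eventually_all_finset t).2 fun g hg => hS g (htS hg))
  obtain ⟨m, hm_far, hnm⟩ := (((Metric.tendsto_dist_left_cobounded_atTop (y n)).comp hy
    |>.eventually_ge_atTop R).and (eventually_ge_atTop n)).exists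
  have hsub : (t : Set G) ⊆ coarseStabilizer ρ (max ε 1) {y n, y m} := by
    rintro g hg _ (rfl | rfl)
    · exact (hn n le_rfl g hg).trans (le_max_left _ _)
    · exact (hn m hnm g hg).trans (le_max_left _ _)
  have hcard := (Set.encard_le_encard hsub).trans (hN _ _ hm_far)
  rw [Set.encard_coe_eq_coe_finsetCard, ht_card] at hcard
  exact absurd (Nat.cast_le.1 hcard) (Nat.not_succ_le_self N)

theorem isElliptic_of_isBounded {o : Y} (ho : Bornology.IsBounded (Set.range fun g => ρ g o)) :
    IsElliptic ρ := by
  obtain ⟨C, hC⟩ := (Metric.isBounded_iff_subset_closedBall o).1 ho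
  refine fun x => (Metric.isBounded_iff_subset_closedBall o).2 ⟨dist x o + C, ?_⟩
  rintro _ ⟨g, rfl⟩
  calc dist (ρ g x) o ≤ dist (ρ g x) (ρ g o) + dist (ρ g o) o := dist_triangle _ _ _
    _ ≤ dist x o + C := add_le_add ((ρ g).dist_eq x o).le (hC ⟨g, rfl⟩)

theorem isElliptic_of_finite [Finite G] (ρ : G →* (Y ≃ᵢ Y)) : IsElliptic ρ :=
  fun _ => (Set.finite_range _).isBounded

theorem IsElliptic.of_finiteIndex {H : Subgroup G} [H.FiniteIndex]
    (hH : IsElliptic (ρ.comp H.subtype)) : IsElliptic ρ := by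
  intro x
  refine (Bornology.isBounded_iUnion.2 fun q : G ⧸ H =>
    (ρ q.out).isometry.lipschitz.isBounded_image (hH x)).subset ?_
  rintro _ ⟨g, rfl⟩
  obtain ⟨h, hh⟩ := QuotientGroup.mk_out_eq_mul H g
  refine Set.mem_iUnion.2 ⟨g, _, ⟨h⁻¹, rfl⟩, ?_⟩
  change (ρ _ * ρ (h : G)⁻¹) x = ρ g x
  rw [← map_mul, hh, mul_inv_cancel_right]

end Actions

/-! ### Finite products -/

instance {G X : Type*} [Group G] [MetricSpace X] [MulAction G X] [IsIsometricSMul G X]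
    (H : Subgroup G) : IsIsometricSMul H X :=
  ⟨fun g => isometry_smul X (g : G)⟩

section Product

variable {ι G : Type*} [Fintype ι] [Group G] {p : ℝ≥0∞} [Fact (1 ≤ p)] {X : ι → Type*}
  [∀ i, MetricSpace (X i)]

section FactorActions

variable [∀ i, MulAction G (X i)] {ρ : G →* (PiLp p X ≃ᵢ PiLp p X)}

theorem isElliptic_of_forall_isBounded_orbit (hρ : ∀ g x i, ρ g x i = g • x i) {o : PiLp p X}
    (ho : ∀ i, Bornology.IsBounded (MulAction.orbit G (o i))) : IsElliptic ρ := by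
  refine isElliptic_of_isBounded (o := o) (((PiLp.antilipschitzWith_ofLp p X).isBounded_preimage
    (Bornology.IsBounded.pi ho)).subset ?_)
  rintro _ ⟨g, rfl⟩ i -
  exact ⟨g, (hρ g o i).symm⟩

theorem exists_surjective_int_hom_of_controlsDisplacement (hρ : ∀ g x i, ρ g x i = g • x i)
    (hacyl : IsAcylindrical ρ) {f : ι → G → ℝ} {C C' : ι → ℝ} {y : ∀ i, ℕ → X i}
    (hf : ∀ i, IsQuasimorphism (f i) (C i)) (hy : ∀ i, ControlsDisplacement (f i) (C' i) (y i))
    {j : ι} (hj : Tendsto (y j) atTop (Bornology.cobounded (X j))) :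
    ∃ k ≤ Fintype.card ι, ∃ ψ : G →* Multiplicative (Fin k → ℤ),
      Function.Surjective ψ ∧ Finite ψ.ker := by
  let z : ℕ → PiLp p X := fun n => WithLp.toLp p fun i => y i n
  have hz : Tendsto z atTop (Bornology.cobounded (PiLp p X)) := by
    rw [← Metric.comap_dist_left_atTop (z 0), tendsto_comap_iff]
    exact tendsto_atTop_mono (fun n => PiLp.dist_apply_le (z 0) (z n) j)
      ((Metric.tendsto_dist_left_cobounded_atTop (y j 0)).comp hj)
  obtain ⟨K, hK⟩ : ∃ K, AntilipschitzWith K (WithLp.ofLp : PiLp p X → ∀ i, X i) :=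
    ⟨_, PiLp.antilipschitzWith_ofLp p X⟩
  refine exists_surjective_int_hom_of_quasimorphisms hf fun B =>
    hacyl.finite_of_eventually_dist_le (ε := K * ‖B + C'‖) hz fun g hg => ?_
  filter_upwards [eventually_all.2 fun i => hy i g] with n hn
  refine (hK.le_mul_dist _ _).trans (mul_le_mul_of_nonneg_left
    ((dist_pi_le_iff (norm_nonneg _)).2 fun i => ?_) K.coe_nonneg)
  calc dist (ρ g (z n) i) (z n i) = dist (g • y i n) (y i n) := by rw [hρ]
    _ ≤ |f i g| + C' i := hn i
    _ ≤ B i + C' i := by gcongr; exact hg i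
    _ ≤ ‖B + C'‖ := (le_abs_self _).trans (norm_le_pi_norm (B + C') i)

variable [∀ i, IsIsometricSMul G (X i)] {δ : ℝ}

theorem exists_surjective_int_hom_of_forall_smul_eq (hX : ∀ i, IsHyperbolicSpace δ (X i))
    (hρ : ∀ g x i, ρ g x i = g • x i) (hacyl : IsAcylindrical ρ) (hell : ¬ IsElliptic ρ)
    {o : PiLp p X} (hfix : ∀ i, Bornology.IsBounded (MulAction.orbit G (o i)) ∨
      ∃ ξ : GromovBoundary (hX i).isGromovHyperbolic, ∀ g : G, g • ξ = ξ) :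
    ∃ k, 1 ≤ k ∧ k ≤ Fintype.card ι ∧ ∃ ψ : G →* Multiplicative (Fin k → ℤ),
      Function.Surjective ψ ∧ Finite ψ.ker := by
  have hctrl : ∀ i, ∃ (f : G → ℝ) (C C' : ℝ) (y : ℕ → X i), IsQuasimorphism f C ∧
      ControlsDisplacement f C' y ∧ (Bornology.IsBounded (MulAction.orbit G (o i)) ∨
        Tendsto y atTop (Bornology.cobounded (X i))) := fun i => by
    rcases hfix i with hb | ⟨ξ, hξ⟩
    · obtain ⟨C', hC'⟩ := exists_controlsDisplacement_of_isBounded hb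
      exact ⟨0, 0, C', _, fun _ _ => by simp, hC', .inl hb⟩
    · obtain ⟨f, C, C', y, hf, hC', hy⟩ := exists_controlsDisplacement_of_forall_smul_eq (hX i)
        (o i) hξ
      exact ⟨f, C, C', y, hf, hC', .inr hy⟩
  choose f C C' y hf hC' hy using hctrl
  obtain ⟨j, hj⟩ := not_forall.1 (mt (isElliptic_of_forall_isBounded_orbit hρ) hell)
  obtain ⟨k, hk, ψ, hψ, hker⟩ := exists_surjective_int_hom_of_controlsDisplacement hρ hacyl hf hC'
    ((hy j).resolve_left hj)
  refine ⟨k, Nat.one_le_iff_ne_zero.2 ?_, hk, ψ, hψ, hker⟩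
  rintro rfl
  have : Finite G := Finite.of_injective (fun g => (⟨g, Subsingleton.elim _ _⟩ : ψ.ker))
    fun _ _ h => congrArg Subtype.val h
  exact hell (isElliptic_of_finite ρ)

omit [Fintype ι] in
theorem containsFreeGroup_or_exists_finiteIndex_forall_smul_eq [Finite ι]
    (hX : ∀ i, IsHyperbolicSpace δ (X i)) (o : ∀ i, X i) :
    ContainsFreeGroup G ∨ ∃ H : Subgroup G, H.FiniteIndex ∧
      ∀ i, Bornology.IsBounded (MulAction.orbit G (o i)) ∨
        ∃ ξ : GromovBoundary (hX i).isGromovHyperbolic, ∀ g ∈ H, g • ξ = ξ := by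
  refine or_iff_not_imp_left.2 fun hfree => ?_
  have hfactor : ∀ i, ∃ H : Subgroup G, H.FiniteIndex ∧
      (Bornology.IsBounded (MulAction.orbit G (o i)) ∨
        ∃ ξ : GromovBoundary (hX i).isGromovHyperbolic, ∀ g ∈ H, g • ξ = ξ) := fun i => by
    by_cases hb : Bornology.IsBounded (MulAction.orbit G (o i))
    · exact ⟨⊤, inferInstance, .inl hb⟩
    · obtain ⟨ξ, hξ⟩ := (containsFreeGroup_or_exists_finiteIndex_stabilizer
        (hX i).isGromovHyperbolic hb).resolve_left hfree
      exact ⟨_, hξ, .inr ⟨ξ, fun _ => id⟩⟩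
  choose H hH hfix using hfactor
  exact ⟨⨅ i, H i, Subgroup.finiteIndex_iInf hH, fun i => (hfix i).imp_right fun ⟨ξ, hξ⟩ =>
    ⟨ξ, fun g hg => hξ g (Subgroup.mem_iInf.1 hg i)⟩⟩

theorem containsFreeGroup_or_virtuallyIsomorphic_int (hX : ∀ i, IsHyperbolicSpace δ (X i))
    (hρ : ∀ g x i, ρ g x i = g • x i) (hacyl : IsAcylindrical ρ) (hell : ¬ IsElliptic ρ) :
    ContainsFreeGroup G ∨ ∃ k, 1 ≤ k ∧ k ≤ Fintype.card ι ∧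
      VirtuallyIsomorphic G (Multiplicative (Fin k → ℤ)) := by
  obtain ⟨o, -⟩ := not_forall.1 hell
  refine (containsFreeGroup_or_exists_finiteIndex_forall_smul_eq hX o).imp_right ?_
  rintro ⟨H, hH, hfix⟩
  obtain ⟨k, hk_pos, hk_le, ψ, hψ, hker⟩ := exists_surjective_int_hom_of_forall_smul_eq
    (ρ := ρ.comp H.subtype) hX (fun g => hρ g) (hacyl.comp_of_injective H.subtype_injective)
    (mt IsElliptic.of_finiteIndex hell) fun i => (hfix i).imp
      (fun hb => hb.subset (by rintro _ ⟨g, rfl⟩; exact ⟨g, rfl⟩))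
      fun ⟨ξ, hξ⟩ => ⟨ξ, fun g => hξ g g.2⟩
  exact ⟨k, hk_pos, hk_le, .of_finiteIndex (.of_surjective ψ hψ)⟩

end FactorActions

variable (p X) in
/-- The isometries of a product that preserve each of its factors. -/
def factorwise : Subgroup (PiLp p X ≃ᵢ PiLp p X) where
  carrier := {f | ∀ i, ∃ e : X i ≃ᵢ X i, ∀ x : PiLp p X, f x i = e (x i)}
  one_mem' := fun i => ⟨IsometryEquiv.refl (X i), fun _ => rfl⟩
  mul_mem' := fun {f g} hf hg i =>
    let ⟨e, he⟩ := hg i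
    let ⟨e', he'⟩ := hf i
    ⟨e.trans e', fun x => (he' (g x)).trans (congrArg e' (he x))⟩
  inv_mem' := fun {f} hf i =>
    let ⟨e, he⟩ := hf i
    ⟨e.symm, fun x => e.eq_symm_apply.2 (by rw [← he, f.apply_inv_self])⟩

theorem inv_mul_mem_factorwise {f g : PiLp p X ≃ᵢ PiLp p X} {σ : Equiv.Perm ι}
    (hf : ∀ i, ∃ e : X i ≃ᵢ X (σ i), ∀ x : PiLp p X, f x (σ i) = e (x i))
    (hg : ∀ i, ∃ e : X i ≃ᵢ X (σ i), ∀ x : PiLp p X, g x (σ i) = e (x i)) :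
    f⁻¹ * g ∈ factorwise p X := by
  intro i
  obtain ⟨e, he⟩ := hf i
  obtain ⟨e', he'⟩ := hg i
  refine ⟨e'.trans e.symm, fun x => e.eq_symm_apply.2 ?_⟩
  rw [← he, IsometryEquiv.mul_apply, IsometryEquiv.apply_inv_self]
  exact he' x

theorem exists_factor_actions {ρ : G →* (PiLp p X ≃ᵢ PiLp p X)}
    (hρ : ∀ g, ρ g ∈ factorwise p X) (o : PiLp p X) :
    ∃ (_ : ∀ i, MulAction G (X i)) (_ : ∀ i, IsIsometricSMul G (X i)),
      ∀ g x i, ρ g x i = g • x i := by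
  classical
  choose e he using hρ
  have hval : ∀ i (a : X i), ∃ x : PiLp p X, x i = a := fun i a =>
    ⟨WithLp.toLp p (Function.update o i a), Function.update_self i a _⟩
  have hone : ∀ i (a : X i), e 1 i a = a := fun i a => by
    obtain ⟨x, rfl⟩ := hval i a
    rw [← he, map_one]
    rfl
  have hmul : ∀ g h i (a : X i), e (g * h) i a = e g i (e h i a) := fun g h i a => by
    obtain ⟨x, rfl⟩ := hval i a
    rw [← he, ← he, ← he, map_mul, IsometryEquiv.mul_apply]
  let act : ∀ i, MulAction G (X i) := fun i =>
    { smul := fun g => e g i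
      one_smul := hone i
      mul_smul := fun g h => hmul g h i }
  exact ⟨act, fun i => ⟨fun g => (e g i).isometry⟩, fun g x i => he g i x⟩

end Product

theorem finiteIndex_comap_factorwise {G : Type*} [Group G] {D : ℕ} {X : Fin D → Type*}
    [∀ i, MetricSpace (X i)] {p : ℝ≥0∞} [Fact (1 ≤ p)] (ρ : G →* autProd p X) :
    ((factorwise p X).comap ((autProd p X).subtype.comp ρ)).FiniteIndex := by
  choose σ hσ using fun g => (ρ g).2
  rw [Subgroup.finiteIndex_iff_finite_quotient]
  refine Finite.of_injective (fun q => σ (Quotient.out q)) fun q q' hqq' => ?_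
  rw [← QuotientGroup.out_eq' q, ← QuotientGroup.out_eq' q', QuotientGroup.eq,
    Subgroup.mem_comap, map_mul, map_inv]
  replace hqq' : σ q.out = σ q'.out := hqq'
  exact inv_mul_mem_factorwise (hσ q.out) (hqq' ▸ hσ q'.out)

theorem theoremA_general {Γ : Type*} [Group Γ] {D : ℕ} (X : Fin D → Type*)
    [∀ i, MetricSpace (X i)] (δ : ℝ) (hX : ∀ i, IsHyperbolicSpace δ (X i))
    (p : ℝ≥0∞) [Fact (1 ≤ p)] (ρ : Γ →* autProd p X)
    (hacyl : IsAcylindrical ((autProd p X).subtype.comp ρ))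
    (hell : ¬ IsElliptic ((autProd p X).subtype.comp ρ)) :
    (∃ φ : FreeGroup (Fin 2) →* Γ, Function.Injective φ) ∨
      ∃ k : ℕ, 1 ≤ k ∧ k ≤ D ∧ VirtuallyIsomorphic Γ (Multiplicative (Fin k → ℤ)) := by
  let Γ₀ := (factorwise p X).comap ((autProd p X).subtype.comp ρ)
  have hindex : Γ₀.FiniteIndex := finiteIndex_comap_factorwise ρ
  obtain ⟨o, -⟩ := not_forall.1 hell
  obtain ⟨_, _, hact⟩ := exists_factor_actions
    (ρ := ((autProd p X).subtype.comp ρ).comp Γ₀.subtype) Subtype.property o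
  rcases containsFreeGroup_or_virtuallyIsomorphic_int hX hact
    (hacyl.comp_of_injective Γ₀.subtype_injective) (mt IsElliptic.of_finiteIndex hell) with
    hfree | ⟨k, hk_pos, hk_le, hvi⟩
  · exact .inl (hfree.of_injective Γ₀.subtype_injective)
  · exact .inr ⟨k, hk_pos, hk_le.trans_eq (Fintype.card_fin D), hvi.of_finiteIndex⟩

theorem theoremA {Γ : Type*} [Group Γ] [Countable Γ] {D : ℕ} (X : Fin D → Type*)
    [∀ i, MetricSpace (X i)] [∀ i, CompleteSpace (X i)]
    [∀ i, TopologicalSpace.SeparableSpace (X i)]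
    (δ : ℝ) (hX : ∀ i, IsHyperbolicSpace δ (X i))
    (p : ℝ≥0∞) [Fact (1 ≤ p)] (ρ : Γ →* autProd p X)
    (hacyl : IsAcylindrical ((autProd p X).subtype.comp ρ))
    (hell : ¬ IsElliptic ((autProd p X).subtype.comp ρ)) :
    (∃ φ : FreeGroup (Fin 2) →* Γ, Function.Injective φ) ∨
      ∃ k : ℕ, 1 ≤ k ∧ k ≤ D ∧ VirtuallyIsomorphic Γ (Multiplicative (Fin k → ℤ)) :=
  theoremA_general X δ hX p ρ hacyl hell
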